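/- Let $F$ be a number field, $D\in F^{*}\setminus F^{*2}$, and let $K=F(\sqrt D)$, with Galois group $G=\mathrm{Gal}(K/F)=\langle\sigma\rangle$ of order $2$. Let $E: y^2=x^3+ax+b$ with $a,b\in F$ be an elliptic curve over $F$, and let $E_D: y^2=x^3+aD^2x+bD^3$ be its quadratic $D$-twist. Put $r_F=\operatorname{rank}E(F)$ and $r_{D,F}=\operatorname{rank}E_D(F)$. Regard $E(F)$ as a subgroup of $E(K)$, let $E(F)[2]$ be the subgroup of points $P\in E(F)$ with $2P=O$, and define the subgroups of $E(K)$ $$R_D(F)=\Big\{\Big(\frac{x}{D},\frac{y}{(\sqrt D)^3}\Big):(x,y)\in E_D(F)\Big\}\cup\{O\},\qquad N_D(F)=\{P+\sigma P: P\in E(K)\}.$$ Then the group $H^1(G,E(K))$ is finite, and its order is $$\#H^1(G,E(K))=\frac{2^{r_{D,F}}\cdot\#E(F)[2]}{(E(K):E(F)+R_D(F))}=\frac{2^{r_{D,F}}\cdot\#E(F)[2]}{(N_D(F):2E(F))}=2^{\,r_{D,F}-r_F}\cdot(E(F):N_D(F)),$$ where all the indices are finite. -/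

import Mathlib

open scoped WeierstrassCurve.Affine

namespace QuadTwist

open WeierstrassCurve WeierstrassCurve.Affine

/-- The Weierstrass curve `y² = x³ + a x + b` over `F`. -/
def curve {F : Type*} [Field F] (a b : F) : WeierstrassCurve F := ⟨0, 0, 0, a, b⟩

/-- The quadratic `D`-twist `y² = x³ + a D² x + b D³` of `curve a b`. -/
def twist {F : Type*} [Field F] (a b D : F) : WeierstrassCurve F :=
  curve (a * D ^ 2) (b * D ^ 3)

noncomputable section

variable {F K : Type*} [Field F] [Field K] [Algebra F K] {a b D : F} {δ : K}

lemma nonsingular_curve (a b : F) (x y : K) : ((curve a b)⁄K).Nonsingular x y ↔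
    y ^ 2 = x ^ 3 + algebraMap F K a * x + algebraMap F K b ∧
      (3 * x ^ 2 + algebraMap F K a ≠ 0 ∨ 2 * y ≠ 0) := by
  rw [nonsingular_iff', equation_iff]
  simp only [curve, baseChange_a₁, baseChange_a₂, baseChange_a₃, baseChange_a₄, baseChange_a₆,
    map_zero, zero_mul, mul_zero, add_zero, zero_sub, ne_eq, neg_eq_zero]

lemma nonsingular_twist (hδ : δ ^ 2 = algebraMap F K D) (h0 : δ ≠ 0) {x y : K}
    (h : ((twist a b D)⁄K).Nonsingular x y) :
    ((curve a b)⁄K).Nonsingular (x / δ ^ 2) (y / δ ^ 3) := by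
  rw [twist, nonsingular_curve] at h
  rw [nonsingular_curve]
  simp only [map_mul, map_pow, ← hδ] at h
  refine ⟨?_, h.2.imp (fun h1 h2 ↦ h1 ?_) (fun h1 h2 ↦ h1 ?_)⟩
  · field_simp
    linear_combination h.1
  · field_simp at h2
    linear_combination h2
  · field_simp at h2
    linear_combination h2

lemma negY_curve (a b : F) (x y : K) : ((curve a b)⁄K).negY x y = -y := by
  simp [negY, curve]

lemma slope_twist [DecidableEq K] (hδ : δ ^ 2 = algebraMap F K D) (h0 : δ ≠ 0)
    (x₁ x₂ y₁ y₂ : K) :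
    ((curve a b)⁄K).slope (x₁ / δ ^ 2) (x₂ / δ ^ 2) (y₁ / δ ^ 3) (y₂ / δ ^ 3) =
      ((twist a b D)⁄K).slope x₁ x₂ y₁ y₂ / δ := by
  have e2 : x₁ / δ ^ 2 = x₂ / δ ^ 2 ↔ x₁ = x₂ := div_left_inj' (pow_ne_zero 2 h0)
  have e3 : y₁ / δ ^ 3 = -(y₂ / δ ^ 3) ↔ y₁ = -y₂ := by
    rw [← neg_div]; exact div_left_inj' (pow_ne_zero 3 h0)
  simp only [Affine.slope, twist, negY_curve, e2, e3]
  split_ifs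
  · simp
  · simp only [curve, baseChange_a₁, baseChange_a₂, baseChange_a₄, map_zero, map_mul, map_pow,
      ← hδ, zero_mul, mul_zero, add_zero, sub_zero, sub_neg_eq_add, ← two_mul]
    field_simp
  · field_simp

lemma sqrt_ne_zero (hδ : δ ^ 2 = algebraMap F K D) (hD : D ≠ 0) : δ ≠ 0 := by
  rintro rfl
  exact hD ((map_eq_zero (algebraMap F K)).1 (by rw [← hδ]; simp))

/-- The group homomorphism `φ_D : E_D(K) → E(K)`, `(x, y) ↦ (x / (√D)², y / (√D)³)`, where `δ` is
the chosen square root of `D` in `K`. -/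
def phi [DecidableEq K] (a b : F) (hδ : δ ^ 2 = algebraMap F K D) (hD : D ≠ 0) :
    ((twist a b D)⁄K).Point →+ ((curve a b)⁄K).Point where
  toFun P := match P with
    | .zero => .zero
    | .some x y h => .some (x / δ ^ 2) (y / δ ^ 3) (nonsingular_twist hδ (sqrt_ne_zero hδ hD) h)
  map_zero' := rfl
  map_add' := by
    rintro (_ | ⟨x₁, y₁, h₁⟩) (_ | ⟨x₂, y₂, h₂⟩)
    any_goals rfl
    have h0 := sqrt_ne_zero hδ hD
    have e2 : x₁ / δ ^ 2 = x₂ / δ ^ 2 ↔ x₁ = x₂ := div_left_inj' (pow_ne_zero 2 h0)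
    have e3 : y₁ / δ ^ 3 = ((curve a b)⁄K).negY (x₂ / δ ^ 2) (y₂ / δ ^ 3) ↔
        y₁ = ((twist a b D)⁄K).negY x₂ y₂ := by
      rw [twist, negY_curve, negY_curve, ← neg_div]; exact div_left_inj' (pow_ne_zero 3 h0)
    by_cases hxy : x₁ = x₂ ∧ y₁ = ((twist a b D)⁄K).negY x₂ y₂
    · rw [Point.add_of_Y_eq hxy.1 hxy.2, Point.add_of_Y_eq (e2.2 hxy.1) (e3.2 hxy.2)]
      rfl
    · rw [Point.add_some hxy, Point.add_some (by rwa [e2, e3])]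
      simp only [Point.some.injEq, slope_twist hδ h0]
      simp only [addX, addY, negAddY, negY_curve, twist]
      simp only [curve, baseChange_a₁, baseChange_a₂, map_zero, zero_mul, add_zero, sub_zero]
      constructor <;> field_simp

variable (K) in
/-- `E(F)` as a subgroup of `E(K)`. -/
def EF [DecidableEq F] [DecidableEq K] (a b : F) : AddSubgroup ((curve a b)⁄K).Point :=
  (Point.baseChange (W' := curve a b) F K).range

/-- `R_D(F) = φ_D(E_D(F))`, a subgroup of `E(K)`. -/
def R [DecidableEq F] [DecidableEq K] (a b : F) (hδ : δ ^ 2 = algebraMap F K D) (hD : D ≠ 0) :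
    AddSubgroup ((curve a b)⁄K).Point :=
  ((phi a b hδ hD).comp (Point.baseChange (W' := twist a b D) F K)).range

/-- `N_D(F)`, the image of `P ↦ P + σ P` on `E(K)`. -/
def N [DecidableEq K] (a b : F) (σ : Gal(K/F)) : AddSubgroup ((curve a b)⁄K).Point :=
  (AddMonoidHom.id _ + Point.map (W' := curve a b) (σ : K →ₐ[F] K)).range

variable (K) in
/-- The `Gal(K/F)`-module `E(K)`, with the coordinatewise Galois action. -/
def galoisRep [DecidableEq K] (a b : F) : Representation ℤ Gal(K/F) ((curve a b)⁄K).Point where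
  toFun τ := (Point.map (W' := curve a b) (τ : K →ₐ[F] K)).toIntLinearMap
  map_one' := by
    ext P
    cases P <;> rfl
  map_mul' τ τ' := by
    ext P
    cases P <;> rfl

/-- `H¹(Gal(K/F), E(K))`. -/
abbrev H1 {F : Type*} (K : Type) [Field F] [Field K] [Algebra F K] [DecidableEq K] (a b : F) :=
  groupCohomology.H1 (Rep.of (galoisRep K a b))

end

end QuadTwist

/-! ### The index of `2A` in a finitely generated abelian group -/

namespace AddCommGroup

lemma index_range_nsmul_congr {A B : Type*} [AddCommGroup A] [AddCommGroup B] (e : A ≃+ B) (n : ℕ) :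
    (nsmulAddMonoidHom (α := A) n).range.index = (nsmulAddMonoidHom (α := B) n).range.index := by
  rw [← AddSubgroup.index_map_equiv _ e]
  congr 1
  ext x
  constructor
  · rintro ⟨_, ⟨y, rfl⟩, rfl⟩
    exact ⟨e y, by simp⟩
  · rintro ⟨y, rfl⟩
    exact ⟨n • e.symm y, ⟨e.symm y, rfl⟩, by simp⟩

lemma card_torsionBy_congr {A B : Type*} [AddCommGroup A] [AddCommGroup B] (e : A ≃+ B) (n : ℤ) :
    Nat.card (AddSubgroup.torsionBy A n) = Nat.card (AddSubgroup.torsionBy B n) := by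
  refine Nat.card_congr (e.toEquiv.subtypeEquiv fun a ↦ ?_)
  simp [← map_zsmul]

lemma index_range_nsmul_prod (A B : Type*) [AddCommGroup A] [AddCommGroup B] (n : ℕ) :
    (nsmulAddMonoidHom (α := A × B) n).range.index =
      (nsmulAddMonoidHom (α := A) n).range.index * (nsmulAddMonoidHom (α := B) n).range.index := by
  rw [← AddSubgroup.index_prod]
  congr 1
  ext ⟨x, y⟩
  simp [AddSubgroup.mem_prod, AddMonoidHom.mem_range, Prod.ext_iff]

lemma card_torsionBy_prod (A B : Type*) [AddCommGroup A] [AddCommGroup B] (n : ℤ) :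
    Nat.card (AddSubgroup.torsionBy (A × B) n) =
      Nat.card (AddSubgroup.torsionBy A n) * Nat.card (AddSubgroup.torsionBy B n) := by
  rw [← Nat.card_prod, ← Nat.card_congr
    ((AddSubgroup.torsionBy A n).prodEquiv (AddSubgroup.torsionBy B n)).toEquiv]
  refine Nat.card_congr ((Equiv.refl _).subtypeEquiv fun a ↦ ?_)
  simp [AddSubgroup.mem_prod, Prod.ext_iff]

lemma ker_nsmulAddMonoidHom (A : Type*) [AddCommGroup A] (n : ℕ) :
    (nsmulAddMonoidHom (α := A) n).ker = AddSubgroup.torsionBy A n := by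
  ext x
  simp [AddMonoidHom.mem_ker]

lemma index_range_nsmul_of_finite (A : Type*) [AddCommGroup A] [Finite A] (n : ℕ) :
    (nsmulAddMonoidHom (α := A) n).range.index = Nat.card (AddSubgroup.torsionBy A n) := by
  have h1 := AddSubgroup.card_mul_index (nsmulAddMonoidHom (α := A) n).range
  have h2 := AddSubgroup.card_mul_index (nsmulAddMonoidHom (α := A) n).ker
  rw [AddSubgroup.index_ker, mul_comm, ker_nsmulAddMonoidHom] at h2
  exact Nat.eq_of_mul_eq_mul_left Nat.card_pos (h1.trans h2.symm)

lemma index_range_nsmul_int_fun (m n : ℕ) [NeZero n] :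
    (nsmulAddMonoidHom (α := Fin m → ℤ) n).range.index = n ^ m := by
  let f : (Fin m → ℤ) →+ (Fin m → ZMod n) := (Int.castAddHom (ZMod n)).compLeft (Fin m)
  have hf : Function.Surjective f := fun y ↦
    ⟨fun i ↦ (y i).cast, funext fun i ↦ by simp [f]⟩
  have hker : f.ker = (nsmulAddMonoidHom (α := Fin m → ℤ) n).range := by
    ext x
    simp only [AddMonoidHom.mem_ker, AddMonoidHom.mem_range]
    constructor
    · intro h
      have h' : ∀ i, (n : ℤ) ∣ x i := fun i ↦ by
        rw [← ZMod.intCast_zmod_eq_zero_iff_dvd]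
        exact congrFun h i
      choose y hy using h'
      exact ⟨y, funext fun i ↦ by simp [hy]⟩
    · rintro ⟨y, rfl⟩
      ext i
      simp [f]
  rw [← hker, AddSubgroup.index_ker, AddMonoidHom.range_eq_top.2 hf]
  simp

lemma exists_equiv_int_fun_prod_finite (A : Type*) [AddCommGroup A] [AddGroup.FG A] :
    ∃ (m : ℕ) (T : Type) (_ : AddCommGroup T) (_ : Finite T), Nonempty (A ≃+ (Fin m → ℤ) × T) := by
  obtain ⟨m, ι, _, p, hp, k, ⟨e⟩⟩ := equiv_free_prod_directSum_zmod A
  have hne : ∀ i, NeZero (p i ^ k i) := fun i ↦ ⟨pow_ne_zero _ (hp i).ne_zero⟩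
  classical
  exact ⟨m, _, _, inferInstance,
    ⟨e.trans ((Finsupp.linearEquivFunOnFinite ℤ ℤ (Fin m)).toAddEquiv.prodCongr
      (DirectSum.addEquivProd fun i : ι ↦ ZMod (p i ^ k i)))⟩⟩

lemma card_torsionBy_int_fun (m n : ℕ) [NeZero n] :
    Nat.card (AddSubgroup.torsionBy (Fin m → ℤ) n) = 1 := by
  rw [Nat.card_eq_one_iff_unique]
  refine ⟨⟨fun a b ↦ ?_⟩, ⟨0⟩⟩
  have h : ∀ c : AddSubgroup.torsionBy (Fin m → ℤ) n, (c : Fin m → ℤ) = 0 := fun c ↦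
    (smul_eq_zero.1 c.2).resolve_left (by exact_mod_cast NeZero.ne n)
  exact Subtype.ext ((h a).trans (h b).symm)

lemma finrank_int_fun_prod_finite (m : ℕ) (T : Type*) [AddCommGroup T] [Finite T] :
    Module.finrank ℤ ((Fin m → ℤ) × T) = m := by
  let f := LinearMap.fst ℤ (Fin m → ℤ) T
  have hf : f.ker ≤ Submodule.torsion ℤ ((Fin m → ℤ) × T) := by
    rintro ⟨x, t⟩ hx
    obtain rfl : x = 0 := hx
    refine ⟨⟨(addOrderOf t : ℤ), mem_nonZeroDivisors_of_ne_zero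
      (by exact_mod_cast (addOrderOf_pos t).ne')⟩, Prod.ext (by simp) ?_⟩
    simp [Submonoid.smul_def, addOrderOf_nsmul_eq_zero]
  rw [Module.finrank, ← rank_quotient_eq_of_le_torsion hf, ← Module.finrank,
    (f.quotKerEquivOfSurjective Prod.fst_surjective).finrank_eq, Module.finrank_fin_fun]

/-- In a finitely generated abelian group `A`, the index of `nA` is `n ^ rank A * #A[n]`. -/
theorem index_range_nsmul (A : Type*) [AddCommGroup A] [AddGroup.FG A] (n : ℕ) [NeZero n] :
    (nsmulAddMonoidHom (α := A) n).range.index =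
      n ^ Module.finrank ℤ A * Nat.card (AddSubgroup.torsionBy A n) := by
  obtain ⟨m, T, _, _, ⟨e⟩⟩ := exists_equiv_int_fun_prod_finite A
  rw [index_range_nsmul_congr e, card_torsionBy_congr e, index_range_nsmul_prod,
    card_torsionBy_prod, index_range_nsmul_int_fun, index_range_nsmul_of_finite,
    e.toIntLinearEquiv.finrank_eq, card_torsionBy_int_fun, finrank_int_fun_prod_finite, one_mul]

lemma card_torsionBy_ne_zero (A : Type*) [AddCommGroup A] [AddGroup.FG A] (n : ℕ) [NeZero n] :
    Nat.card (AddSubgroup.torsionBy A n) ≠ 0 := by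
  obtain ⟨m, T, _, _, ⟨e⟩⟩ := exists_equiv_int_fun_prod_finite A
  rw [card_torsionBy_congr e, card_torsionBy_prod, card_torsionBy_int_fun, one_mul]
  exact Nat.card_pos.ne'

end AddCommGroup

/-! ### Abelian groups with an involution -/

namespace AddMonoidHom

variable {A : Type*} [AddCommGroup A] {σ : A →+ A} {B R : AddSubgroup A}

lemma ker_id_add (hR : ∀ x, x ∈ R ↔ σ x = -x) : (AddMonoidHom.id A + σ).ker = R := by
  ext x
  simp [mem_ker, hR, add_eq_zero_iff_eq_neg']

lemma ker_id_sub (hB : ∀ x, x ∈ B ↔ σ x = x) : (AddMonoidHom.id A - σ).ker = B := by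
  ext x
  simp [mem_ker, hB, sub_eq_zero, eq_comm (a := x)]

lemma map_id_add_sup (hB : ∀ x, x ∈ B ↔ σ x = x) (hR : ∀ x, x ∈ R ↔ σ x = -x) :
    (B ⊔ R).map (AddMonoidHom.id A + σ) = B.map (nsmulAddMonoidHom 2) := by
  rw [AddSubgroup.map_sup, (AddSubgroup.map_eq_bot_iff _).2 (ker_id_add hR).ge, sup_bot_eq]
  ext x
  simp only [AddSubgroup.mem_map]
  refine exists_congr fun y ↦ and_congr_right fun hy ↦ ?_
  simp [(hB y).1 hy, two_nsmul]

lemma map_id_sub_sup (hB : ∀ x, x ∈ B ↔ σ x = x) (hR : ∀ x, x ∈ R ↔ σ x = -x) :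
    (B ⊔ R).map (AddMonoidHom.id A - σ) = R.map (nsmulAddMonoidHom 2) := by
  rw [AddSubgroup.map_sup, (AddSubgroup.map_eq_bot_iff _).2 (ker_id_sub hB).ge, bot_sup_eq]
  ext x
  simp only [AddSubgroup.mem_map]
  refine exists_congr fun y ↦ and_congr_right fun hy ↦ ?_
  simp [(hR y).1 hy, two_nsmul]

/-- `(N : 2B) = (A : B + R)`, where `N` is the image of the norm `1 + σ`. -/
lemma relIndex_range_id_add (hB : ∀ x, x ∈ B ↔ σ x = x) (hR : ∀ x, x ∈ R ↔ σ x = -x) :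
    (B.map (nsmulAddMonoidHom 2)).relIndex (AddMonoidHom.id A + σ).range = (B ⊔ R).index := by
  rw [← map_id_add_sup hB hR, range_eq_map, AddSubgroup.relIndex_map_map, ker_id_add hR,
    sup_assoc, sup_idem, top_sup_eq, AddSubgroup.relIndex_top_right]

lemma relIndex_range_id_sub (hB : ∀ x, x ∈ B ↔ σ x = x) (hR : ∀ x, x ∈ R ↔ σ x = -x) :
    (R.map (nsmulAddMonoidHom 2)).relIndex (AddMonoidHom.id A - σ).range = (B ⊔ R).index := by
  rw [← map_id_sub_sup hB hR, range_eq_map, AddSubgroup.relIndex_map_map, ker_id_sub hB,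
    sup_right_comm, sup_idem, top_sup_eq, AddSubgroup.relIndex_top_right]

lemma relIndex_range_nsmul {G : Type*} [AddCommGroup G] [AddGroup.FG G] {f : G →+ A}
    (hf : Function.Injective f) (n : ℕ) [NeZero n] :
    (f.range.map (nsmulAddMonoidHom n)).relIndex f.range =
      n ^ Module.finrank ℤ G * Nat.card (AddSubgroup.torsionBy G n) := by
  have h : f.range.map (nsmulAddMonoidHom n) = (nsmulAddMonoidHom (α := G) n).range.map f := by
    ext x
    simp only [AddSubgroup.mem_map, AddMonoidHom.mem_range]
    constructor
    · rintro ⟨_, ⟨y, rfl⟩, rfl⟩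
      exact ⟨n • y, ⟨y, rfl⟩, by simp⟩
    · rintro ⟨_, ⟨y, rfl⟩, rfl⟩
      exact ⟨f y, ⟨y, rfl⟩, by simp⟩
  rw [h, range_eq_map f, AddSubgroup.relIndex_map_map_of_injective _ _ hf,
    AddSubgroup.relIndex_top_right, AddCommGroup.index_range_nsmul]

lemma card_torsionBy_range {G : Type*} [AddCommGroup G] {f : G →+ A}
    (hf : Function.Injective f) :
    Nat.card (AddSubgroup.torsionBy G 2) = Nat.card {x : A // x ∈ f.range ∧ (2 : ℤ) • x = 0} := by
  refine Nat.card_congr (Equiv.ofBijective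
    (fun x ↦ ⟨f x, ⟨x, rfl⟩, by rw [← map_zsmul, show (2 : ℤ) • (x : G) = 0 from x.2, map_zero]⟩)
    ⟨fun x y h ↦ Subtype.ext (hf (congrArg Subtype.val h)), ?_⟩)
  rintro ⟨_, ⟨x, rfl⟩, hx⟩
  exact ⟨⟨x, hf (show f ((2 : ℤ) • x) = f 0 by rw [map_zsmul, hx, map_zero])⟩, rfl⟩

/-- The indices attached to an involution `σ` of an abelian group `A` whose fixed subgroup `f(G)`
and whose anti-fixed subgroup `g(H)` are finitely generated. -/
theorem indices_of_involution {G H : Type*} [AddCommGroup G] [AddGroup.FG G] [AddCommGroup H]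
    [AddGroup.FG H] {f : G →+ A} {g : H →+ A} (hf : Function.Injective f)
    (hg : Function.Injective g) (hσ : ∀ x, σ (σ x) = x)
    (hB : ∀ x, x ∈ f.range ↔ σ x = x) (hR : ∀ x, x ∈ g.range ↔ σ x = -x) :
    (f.range ⊔ g.range).index ≠ 0 ∧
    (f.range ⊔ g.range).index * (AddMonoidHom.id A - σ).range.relIndex g.range =
      2 ^ Module.finrank ℤ H * Nat.card (AddSubgroup.torsionBy G 2) ∧
    (f.range ⊔ g.range).index * (AddMonoidHom.id A + σ).range.relIndex f.range =
      2 ^ Module.finrank ℤ G * Nat.card (AddSubgroup.torsionBy G 2) ∧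
    Nat.card (AddSubgroup.torsionBy G 2) ≠ 0 := by
  have hcard : Nat.card (AddSubgroup.torsionBy G 2) = Nat.card (AddSubgroup.torsionBy H 2) := by
    rw [card_torsionBy_range hf, card_torsionBy_range hg]
    refine Nat.card_congr ((Equiv.refl A).subtypeEquiv fun x ↦ and_congr_left fun hx ↦ ?_)
    rw [two_zsmul, add_eq_zero_iff_eq_neg] at hx
    rw [hB, Equiv.refl_apply, hR, ← hx]
  have h1 : (AddMonoidHom.id A - σ).range ≤ g.range := by
    rintro _ ⟨x, rfl⟩
    rw [hR]
    simp [hσ]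
  have h2 : (AddMonoidHom.id A + σ).range ≤ f.range := by
    rintro _ ⟨x, rfl⟩
    rw [hB]
    simp [hσ, add_comm]
  have h3 : g.range.map (nsmulAddMonoidHom 2) ≤ (AddMonoidHom.id A - σ).range := by
    rw [← map_id_sub_sup hB hR]
    exact AddSubgroup.map_le_range _ _
  have h4 : f.range.map (nsmulAddMonoidHom 2) ≤ (AddMonoidHom.id A + σ).range := by
    rw [← map_id_add_sup hB hR]
    exact AddSubgroup.map_le_range _ _
  have h5 := AddSubgroup.relIndex_mul_relIndex _ _ _ h3 h1
  have h6 := AddSubgroup.relIndex_mul_relIndex _ _ _ h4 h2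
  rw [relIndex_range_id_sub hB hR, relIndex_range_nsmul hg 2] at h5
  rw [relIndex_range_id_add hB hR, relIndex_range_nsmul hf 2] at h6
  have hpos : Nat.card (AddSubgroup.torsionBy G 2) ≠ 0 :=
    AddCommGroup.card_torsionBy_ne_zero G 2
  refine ⟨fun h ↦ ?_, h5.trans (by rw [hcard]; rfl), h6, hpos⟩
  rw [h, zero_mul, eq_comm, mul_eq_zero] at h6
  exact h6.elim (by simp) hpos

end AddMonoidHom

/-! ### The naive height on an elliptic curve in short Weierstrass form -/

namespace WeierstrassCurve.Affine.Point

open Height MvPolynomial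

variable {L : Type*} [Field L] {W : Affine L}

lemma finite_setOf_xRep_mem {s : Set (Fin 2 → L)} (hs : s.Finite) :
    {P : W.Point | P.xRep ∈ s}.Finite := by
  refine hs.preimage' (f := fun P : W.Point ↦ P.xRep) fun v _ ↦ ?_
  by_cases hv : ∃ Q : W.Point, Q.xRep = v
  · obtain ⟨Q, rfl⟩ := hv
    exact (Set.toFinite {Q, -Q}).subset fun P hP ↦ eq_or_eq_neg_of_xRep_eq_xRep hP
  · convert Set.finite_empty
    ext P
    simpa using fun h ↦ hv ⟨P, h⟩

lemma northcott_logHeight_xRep [NumberField L] :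
    Northcott (fun P : W.Point ↦ logHeight P.xRep) where
  finite_le B := by
    have hfin : (insert ![1, 0] (Set.image (fun x : L ↦ ![x, 1]) {x | logHeight₁ x ≤ B})).Finite :=
      ((Northcott.finite_le B).image _).insert _
    refine (finite_setOf_xRep_mem (W := W) hfin).subset ?_
    rintro (_ | ⟨x, y, h⟩) hP
    · exact Or.inl rfl
    · refine Or.inr ⟨x, ?_, rfl⟩
      rw [Set.mem_ofPred_eq, logHeight₁_eq_logHeight]
      exact hP

variable [W.IsShortNF]

lemma eval_addSubMap (s t u : L) : (fun i ↦ (addSubMap W i).eval ![s, t, u]) =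
    ![s ^ 2 - 2 * W.a₄ * s * u - 4 * W.a₆ * t * u + W.a₄ ^ 2 * u ^ 2,
      2 * t * s + 2 * W.a₄ * t * u + 4 * W.a₆ * u ^ 2, t ^ 2 - 4 * s * u] := by
  ext i
  fin_cases i <;> simp [addSubMap, b₂, b₄, b₆, b₈]

variable [DecidableEq L]

lemma exists_eval_addSubMap_eq_of_X_ne {x₁ y₁ x₂ y₂ : L} (h₁ : W.Nonsingular x₁ y₁)
    (h₂ : W.Nonsingular x₂ y₂) (hx : x₁ ≠ x₂) :
    ∃ c : L, c ≠ 0 ∧ (fun i ↦ (addSubMap W i).eval ((some _ _ h₁).sym2x (some _ _ h₂))) =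
      c • (some _ _ h₁ + some _ _ h₂).sym2x (some _ _ h₁ - some _ _ h₂) := by
  have e₁ := (equation_iff ..).1 h₁.1
  have e₂ := (equation_iff ..).1 h₂.1
  simp only [a₁_of_isShortNF, a₂_of_isShortNF, a₃_of_isShortNF, zero_mul, add_zero] at e₁ e₂
  have hx' : x₁ - x₂ ≠ 0 := sub_ne_zero.2 hx
  refine ⟨(x₁ - x₂) ^ 2, pow_ne_zero 2 hx', ?_⟩
  rw [sub_eq_add_neg (some _ _ h₁), neg_some, add_of_X_ne hx, add_of_X_ne hx,
    sym2x_some_some, sym2x_some_some, eval_addSubMap]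
  simp only [slope_of_X_ne hx, addX, negY, a₁_of_isShortNF, a₂_of_isShortNF, a₃_of_isShortNF,
    zero_mul, add_zero, sub_zero]
  obtain h6 : W.a₆ = y₁ ^ 2 - x₁ ^ 3 - W.a₄ * x₁ := by linear_combination -e₁
  obtain h4 : W.a₄ = (y₁ ^ 2 - y₂ ^ 2 - (x₁ ^ 3 - x₂ ^ 3)) / (x₁ - x₂) := by
    rw [eq_div_iff hx']; linear_combination e₂ - e₁
  ext i
  fin_cases i
  · simp
    rw [h6, h4]
    field_simp
    ring
  · simp
    rw [h6, h4]
    field_simp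
    ring
  · simp
    ring

lemma exists_eval_addSubMap_self {x y : L} (h : W.Nonsingular x y) :
    ∃ c : L, c ≠ 0 ∧ (fun i ↦ (addSubMap W i).eval ((some _ _ h).sym2x (some _ _ h))) =
      c • (some _ _ h + some _ _ h).sym2x 0 := by
  have e := (equation_iff ..).1 h.1
  have hn := ((nonsingular_iff' ..).1 h).2
  simp only [a₁_of_isShortNF, a₂_of_isShortNF, a₃_of_isShortNF, zero_mul, mul_zero, add_zero,
    zero_sub, neg_ne_zero] at e hn
  rw [sym2x_some_some, eval_addSubMap]
  have h6 : W.a₆ = y ^ 2 - x ^ 3 - W.a₄ * x := by linear_combination -e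
  have hneg : W.negY x y = -y := by simp [negY]
  by_cases hy : 2 * y = 0
  · rw [add_self_of_Y_eq (by rw [hneg]; linear_combination hy), sym2x_zero_zero]
    refine ⟨(3 * x ^ 2 + W.a₄) ^ 2, pow_ne_zero 2 (by simpa [hy] using hn), ?_⟩
    ext i
    fin_cases i
    · simp
      rw [h6]
      linear_combination -4 * x * y * hy
    · simp
      rw [h6]
      linear_combination 2 * y * hy
    · simp
      ring
  · have hy' : y ≠ W.negY x y := by
      rw [hneg]
      exact fun h ↦ hy (by linear_combination h)
    rw [add_self_of_Y_ne hy', sym2x_some_zero]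
    have h2 : (2 : L) ≠ 0 := left_ne_zero_of_mul hy
    have hy0 : y ≠ 0 := right_ne_zero_of_mul hy
    refine ⟨(2 * y) ^ 2, pow_ne_zero 2 hy, ?_⟩
    simp only [slope_of_Y_ne rfl hy', addX, hneg, a₁_of_isShortNF, a₂_of_isShortNF,
      zero_mul, mul_zero, add_zero, sub_zero, sub_neg_eq_add, ← two_mul]
    ext i
    fin_cases i
    · simp
      rw [h6]
      field_simp
      ring
    · simp
      rw [h6]
      ring
    · simp
      ring

/-- `addSubMap` computes `{x(P + Q), x(P - Q)}` from `{x(P), x(Q)}`, up to scaling. -/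
theorem exists_eval_addSubMap_eq (P Q : W.Point) :
    ∃ c : L, c ≠ 0 ∧ (fun i ↦ (addSubMap W i).eval (P.sym2x Q)) = c • (P + Q).sym2x (P - Q) := by
  have zero_left (Q : W.Point) : ∃ c : L, c ≠ 0 ∧
      (fun i ↦ (addSubMap W i).eval ((0 : W.Point).sym2x Q)) = c • Q.sym2x Q := by
    refine ⟨1, one_ne_zero, ?_⟩
    rcases Q with _ | ⟨x, y, h⟩
    · rw [← zero_def, sym2x_zero_zero, eval_addSubMap]
      ext i
      fin_cases i <;> simp
    · rw [sym2x_zero_some, sym2x_some_some, eval_addSubMap]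
      ext i
      fin_cases i <;> simp <;> ring
  rcases P with _ | ⟨x₁, y₁, h₁⟩
  · rw [← zero_def, zero_add, zero_sub, sym2x_neg_right]
    exact zero_left Q
  rcases Q with _ | ⟨x₂, y₂, h₂⟩
  · rw [← zero_def, add_zero, sub_zero, sym2x_comm]
    exact zero_left _
  by_cases hx : x₁ = x₂
  · rcases X_eq_iff (h₁ := h₁) (h₂ := h₂) |>.1 hx with h | h
    · rw [h, sub_self]
      exact exists_eval_addSubMap_self h₂
    · rw [h, neg_add_cancel, sym2x_neg_left, sym2x_comm 0, ← neg_add', sym2x_neg_left]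
      exact exists_eval_addSubMap_self h₂
  · exact exists_eval_addSubMap_eq_of_X_ne h₁ h₂ hx

/-- The approximate parallelogram law for the naive height. -/
theorem exists_abs_logHeight_xRep_add_sub_le [AdmissibleAbsValues L]
    [WeierstrassCurve.IsElliptic W] :
    ∃ C : ℝ, ∀ P Q : W.Point, |logHeight (P + Q).xRep + logHeight (P - Q).xRep -
      2 * (logHeight P.xRep + logHeight Q.xRep)| ≤ C := by
  obtain ⟨C₁, h₁⟩ := abs_logHeight_addSubMap_sub_two_mul_logHeight_le W
  obtain ⟨C₂, h₂⟩ := abs_logHeight_sym2_sub_le L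
  have h₂' (P Q : W.Point) :
      |logHeight (P.sym2x Q) - (logHeight P.xRep + logHeight Q.xRep)| ≤ C₂ := by
    have e (P : W.Point) : ![P.xRep 0, P.xRep 1] = P.xRep := by
      ext i
      fin_cases i <;> rfl
    have := h₂ (by rw [e]; exact xRep_ne_zero P) (by rw [e]; exact xRep_ne_zero Q)
    rwa [e, e] at this
  refine ⟨C₁ + C₂ + 2 * C₂, fun P Q ↦ ?_⟩
  have i₁ := h₁ (P.sym2x Q)
  obtain ⟨c, hc, e⟩ := exists_eval_addSubMap_eq P Q
  rw [e, logHeight_smul_eq_logHeight _ hc] at i₁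
  have i₂ := h₂' P Q
  have i₃ := h₂' (P + Q) (P - Q)
  rw [abs_le] at *
  constructor <;> linarith

end WeierstrassCurve.Affine.Point

/-! ### Finiteness of the group of elements with even valuation outside a finite set -/

/-- A subgroup `K` has finite index in `H` if a function to a finite type separates the cosets. -/
@[to_additive]
lemma Subgroup.relIndex_ne_zero_of_finite {G α : Type*} [Group G] [Finite α] {K H : Subgroup G}
    (f : G → α) (hf : ∀ x ∈ H, ∀ y ∈ H, f x = f y → x⁻¹ * y ∈ K) : K.relIndex H ≠ 0 := by
  have : Finite (H ⧸ K.subgroupOf H) := by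
    refine Finite.of_injective (fun q ↦ f (Quotient.out q : H)) fun q r hqr ↦ ?_
    rw [← QuotientGroup.out_eq' q, ← QuotientGroup.out_eq' r, QuotientGroup.eq]
    exact hf _ (Subtype.mem _) _ (Subtype.mem _) hqr
  exact Subgroup.index_ne_zero_of_finite

/-- A variant of `AddSubgroup.relIndex_ne_zero_of_finite` ignoring a finite set `T`. -/
lemma AddSubgroup.index_ne_zero_of_finite_of_notMem {G α : Type*} [AddGroup G] [Finite α]
    {K : AddSubgroup G} {T : Set G} (hT : T.Finite) (f : G → α)
    (hf : ∀ x ∉ T, ∀ y ∉ T, f x = f y → -x + y ∈ K) : K.index ≠ 0 := by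
  classical
  have := hT.to_subtype
  rw [← AddSubgroup.relIndex_top_right]
  refine AddSubgroup.relIndex_ne_zero_of_finite
    (fun x ↦ (f x, if h : x ∈ T then some (⟨x, h⟩ : T) else none)) fun x _ y _ hxy ↦ ?_
  rw [Prod.mk.injEq] at hxy
  by_cases hx : x ∈ T <;> by_cases hy : y ∈ T
  · rw [dif_pos hx, dif_pos hy, Option.some.injEq, Subtype.mk.injEq] at hxy
    rw [hxy.2, neg_add_cancel]
    exact K.zero_mem
  · simp [hx, hy] at hxy
  · simp [hx, hy] at hxy
  · exact hf x hx y hy hxy.1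

lemma WithZero.isSquare_exp_iff {n : ℤ} : IsSquare (WithZero.exp n) ↔ Even n := by
  constructor
  · rintro ⟨r, hr⟩
    have hr0 : r ≠ 0 := by
      rintro rfl
      simp at hr
    refine ⟨WithZero.log r, ?_⟩
    rw [← WithZero.log_mul hr0 hr0, ← hr, WithZero.log_exp]
  · rintro ⟨m, rfl⟩
    exact ⟨WithZero.exp m, by rw [WithZero.exp_add]⟩

lemma WithZero.isSquare_mul_of_not_isSquare {x y : WithZero (Multiplicative ℤ)}
    (hx : ¬ IsSquare x) (hy : ¬ IsSquare y) : IsSquare (x * y) := by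
  have hx0 : x ≠ 0 := by rintro rfl; exact hx (by simp)
  have hy0 : y ≠ 0 := by rintro rfl; exact hy (by simp)
  rw [← WithZero.exp_log hx0] at hx ⊢
  rw [← WithZero.exp_log hy0] at hy ⊢
  rw [← WithZero.exp_add]
  rw [WithZero.isSquare_exp_iff, Int.not_even_iff_odd] at *
  exact hx.add_odd hy

namespace IsDedekindDomain

open nonZeroDivisors

lemma relIndex_sq_units_sup_sq_ne_zero {R K : Type*} [CommRing R] [Field K] [Algebra R K]
    [Group.FG Rˣ] :
    (powMonoidHom 2 : Kˣ →* Kˣ).range.relIndex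
      ((Units.map (algebraMap R K : R →* K)).range ⊔ (powMonoidHom 2).range) ≠ 0 := by
  rw [Subgroup.relIndex_sup_right, MonoidHom.range_eq_map (Units.map (algebraMap R K : R →* K)),
    ← Subgroup.relIndex_comap, Subgroup.relIndex_top_right]
  have h : (powMonoidHom 2 : Rˣ →* Rˣ).range ≤
      (powMonoidHom 2 : Kˣ →* Kˣ).range.comap (Units.map (algebraMap R K : R →* K)) := by
    rintro _ ⟨u, rfl⟩
    exact ⟨Units.map (algebraMap R K : R →* K) u, by simp⟩
  refine ne_zero_of_dvd_ne_zero ?_ (Subgroup.index_dvd_of_le h)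
  have := AddCommGroup.index_range_nsmul (Additive Rˣ) 2
  have h2 := AddCommGroup.card_torsionBy_ne_zero (Additive Rˣ) 2
  change (nsmulAddMonoidHom (α := Additive Rˣ) 2).range.index ≠ 0
  rw [this]
  exact mul_ne_zero (by simp) h2

variable {R : Type*} [CommRing R] [IsDedekindDomain R] (K : Type*) [Field K] [Algebra R K]
  [IsFractionRing R K]

/-- The elements of `Kˣ` with even valuation at all primes outside `S`. -/
def evenSubgroup (S : Set (HeightOneSpectrum R)) : Subgroup Kˣ where
  carrier := {x | ∀ v ∉ S, IsSquare (v.valuation K (x : K))}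
  one_mem' v _ := by simp
  mul_mem' hx hy v hv := by
    rw [Units.val_mul, map_mul]
    exact (hx v hv).mul (hy v hv)
  inv_mem' hx v hv := by
    rw [Units.val_inv_eq_inv_val, map_inv₀]
    exact (hx v hv).inv

variable {K}

lemma relIndex_evenSubgroup_empty_ne_zero {S : Set (HeightOneSpectrum R)} (hS : S.Finite) :
    (evenSubgroup K (∅ : Set (HeightOneSpectrum R))).relIndex (evenSubgroup K S) ≠ 0 := by
  classical
  have := hS.to_subtype
  refine Subgroup.relIndex_ne_zero_of_finite
    (fun x (v : S) ↦ decide (IsSquare (v.1.valuation K (x : K)))) fun x hx y hy hxy v _ ↦ ?_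
  rw [Units.val_mul, Units.val_inv_eq_inv_val, map_mul, map_inv₀]
  by_cases hv : v ∈ S
  · have h := congrFun hxy ⟨v, hv⟩
    simp only [decide_eq_decide] at h
    by_cases h' : IsSquare (v.valuation K (x : K))
    · exact h'.inv.mul (h.1 h')
    · exact WithZero.isSquare_mul_of_not_isSquare (by rwa [isSquare_inv]) (fun hy ↦ h' (h.2 hy))
  · exact (hx v hv).inv.mul (hy v hv)

/-- An ideal generated by an element all of whose valuations are even is a square. -/
lemma exists_sq_eq_span_of_isSquare_intValuation {r : R} (hr : r ≠ 0)
    (h : ∀ v : HeightOneSpectrum R, IsSquare (v.intValuation r)) :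
    ∃ I : (Ideal R)⁰, (I : Ideal R) ^ 2 = Ideal.span {r} := by
  classical
  have hI : Ideal.span {r} ≠ 0 := by simpa using hr
  let n (v : HeightOneSpectrum R) : ℕ :=
    (Associates.mk v.asIdeal).count (Associates.mk (Ideal.span {r})).factors
  have hn (v) : Even (n v) := by
    have := h v
    rw [v.intValuation_if_neg hr, WithZero.isSquare_exp_iff, even_neg] at this
    exact_mod_cast this
  have hfin : Function.HasFiniteMulSupport
      fun v : HeightOneSpectrum R ↦ v.asIdeal ^ (n v / 2) := by
    refine (Filter.eventually_cofinite.1 (Associates.finite_factors hI)).subset fun v hv h0 ↦ hv ?_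
    have h0' : n v = 0 := by exact_mod_cast h0
    simp [h0']
  have hsq : (∏ᶠ v : HeightOneSpectrum R, v.asIdeal ^ (n v / 2)) ^ 2 = Ideal.span {r} := by
    rw [finprod_pow hfin]
    conv_rhs => rw [← Ideal.finprod_heightOneSpectrum_factorization hI]
    refine finprod_congr fun v ↦ ?_
    rw [← pow_mul, Nat.div_mul_cancel (hn v).two_dvd]
    rfl
  refine ⟨⟨_, mem_nonZeroDivisors_of_ne_zero fun h0 ↦ hI ?_⟩, hsq⟩
  rw [← hsq, h0, zero_pow two_ne_zero]

lemma exists_sq_ideal_of_mem_evenSubgroup {x : Kˣ}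
    (hx : x ∈ evenSubgroup K (∅ : Set (HeightOneSpectrum R))) :
    ∃ (I : (Ideal R)⁰) (r d : R), d ≠ 0 ∧ (x : K) * algebraMap R K d ^ 2 = algebraMap R K r ∧
      (I : Ideal R) ^ 2 = Ideal.span {r} := by
  obtain ⟨n, d, hd, hxd⟩ := IsFractionRing.div_surjective (A := R) (x : K)
  have hd0 : d ≠ 0 := nonZeroDivisors.ne_zero hd
  have hd' : algebraMap R K d ≠ 0 := by simpa using hd0
  have hn0 : n ≠ 0 := by
    rintro rfl
    exact x.ne_zero (by simp [← hxd])
  have e : (x : K) * algebraMap R K d ^ 2 = algebraMap R K (n * d) := by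
    rw [← hxd, map_mul]
    field_simp
  obtain ⟨I, hI⟩ := exists_sq_eq_span_of_isSquare_intValuation (mul_ne_zero hn0 hd0) fun v ↦ by
    rw [← v.valuation_of_algebraMap (K := K)]
    change IsSquare (v.valuation K (algebraMap R K (n * d)))
    rw [← e, map_mul, map_pow]
    exact (hx v (Set.notMem_empty v)).mul (IsSquare.sq _)
  exact ⟨I, n * d, d, hd0, e, hI⟩

lemma relIndex_units_sup_sq_ne_zero [Finite (ClassGroup R)] :
    ((Units.map (algebraMap R K : R →* K)).range ⊔ (powMonoidHom 2).range).relIndex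
      (evenSubgroup K (∅ : Set (HeightOneSpectrum R))) ≠ 0 := by
  classical
  refine Subgroup.relIndex_ne_zero_of_finite (fun x ↦
    if h : x ∈ evenSubgroup K (∅ : Set (HeightOneSpectrum R)) then
      ClassGroup.mk0 (exists_sq_ideal_of_mem_evenSubgroup h).choose else 1) fun x hx y hy hxy ↦ ?_
  simp only [dif_pos hx, dif_pos hy] at hxy
  obtain ⟨r, d, hd, hr, hI⟩ := (exists_sq_ideal_of_mem_evenSubgroup hx).choose_spec
  obtain ⟨s, e, he, hs, hJ⟩ := (exists_sq_ideal_of_mem_evenSubgroup hy).choose_spec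
  obtain ⟨a, b, ha, hb, hab⟩ := ClassGroup.mk0_eq_mk0_iff.1 hxy
  have hspan : Ideal.span {a ^ 2 * r} = Ideal.span {b ^ 2 * s} := by
    have := congrArg (· ^ 2) hab
    simpa only [mul_pow, hI, hJ, Ideal.span_singleton_pow, Ideal.span_singleton_mul_span_singleton]
      using this
  obtain ⟨u, hu⟩ := Ideal.span_singleton_eq_span_singleton.1 hspan
  have hu' := congrArg (algebraMap R K) hu
  simp only [map_mul, map_pow, ← hr, ← hs] at hu'
  have hK {z : R} (hz : z ≠ 0) : algebraMap R K z ≠ 0 := by simpa using hz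
  let c : Kˣ := Units.mk0 _
    (div_ne_zero (mul_ne_zero (hK ha) (hK hd)) (mul_ne_zero (hK hb) (hK he)))
  have : x⁻¹ * y = Units.map (algebraMap R K : R →* K) u * c ^ 2 := by
    rw [inv_mul_eq_iff_eq_mul]
    ext
    have := hK ha
    have := hK hb
    have := hK hd
    have := hK he
    simp only [Units.val_mul, Units.coe_map, Units.val_pow_eq_pow_val, c, Units.val_mk0,
      MonoidHom.coe_coe]
    field_simp
    linear_combination -hu'
  rw [this]
  exact Subgroup.mul_mem_sup ⟨u, rfl⟩ ⟨c, rfl⟩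

/-- Modulo squares, only finitely many elements of `Kˣ` have even valuation outside the finite
set `S`. -/
theorem relIndex_sq_evenSubgroup_ne_zero [Finite (ClassGroup R)] [Group.FG Rˣ]
    {S : Set (HeightOneSpectrum R)} (hS : S.Finite) :
    (powMonoidHom 2 : Kˣ →* Kˣ).range.relIndex (evenSubgroup K S) ≠ 0 :=
  Subgroup.relIndex_ne_zero_trans (relIndex_sq_units_sup_sq_ne_zero (R := R) (K := K))
    (Subgroup.relIndex_ne_zero_trans relIndex_units_sup_sq_ne_zero
      (relIndex_evenSubgroup_empty_ne_zero hS))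

variable (K) in
/-- The square class of an element of `K` with even valuation outside the finite set `S` is
determined by an invariant with finitely many values. -/
lemma exists_finite_invariant_sq_class [Finite (ClassGroup R)] [Group.FG Rˣ]
    {S : Set (HeightOneSpectrum R)} (hS : S.Finite) :
    ∃ (n : ℕ) (g : K → Fin n), ∀ z w : K, z ≠ 0 → w ≠ 0 →
      (∀ v ∉ S, IsSquare (v.valuation K z)) → (∀ v ∉ S, IsSquare (v.valuation K w)) →
      g z = g w → IsSquare (z * w) := by
  classical
  let H := evenSubgroup K S
  let N := (powMonoidHom 2 : Kˣ →* Kˣ).range.subgroupOf H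
  have : N.FiniteIndex := ⟨relIndex_sq_evenSubgroup_ne_zero hS⟩
  obtain ⟨n, ⟨e⟩⟩ := Finite.exists_equiv_fin (H ⧸ N)
  refine ⟨n, fun z ↦ e
    (if h : ∃ hz : z ≠ 0, Units.mk0 z hz ∈ H then QuotientGroup.mk ⟨_, h.2⟩ else 1),
    fun z w hz hw hzS hwS hzw ↦ ?_⟩
  replace hzw := e.injective hzw
  rw [dif_pos ⟨hz, hzS⟩, dif_pos ⟨hw, hwS⟩, QuotientGroup.eq] at hzw
  obtain ⟨c, hc⟩ := hzw
  have hc' : (c : K) ^ 2 = z⁻¹ * w := by simpa using congrArg Units.val hc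
  refine ⟨z * c, ?_⟩
  field_simp at hc'
  linear_combination -z * hc'

end IsDedekindDomain

/-! ### The weak Mordell-Weil theorem for curves with full rational 2-torsion -/

section Valuation

variable {L Γ : Type*} [Field L] [LinearOrderedCommGroupWithZero Γ] (v : Valuation L Γ)

lemma Valuation.isSquare_sub_root {x y e₁ e₂ e₃ : L}
    (h : y ^ 2 = (x - e₁) * (x - e₂) * (x - e₃)) (h₁ : v e₁ ≤ 1) (h₂ : v e₂ ≤ 1) (h₃ : v e₃ ≤ 1)
    (h₁₂ : v (e₁ - e₂) = 1) (h₁₃ : v (e₁ - e₃) = 1) : IsSquare (v (x - e₁)) := by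
  have hv := congrArg v h
  simp only [map_mul, map_pow] at hv
  rcases lt_or_ge 1 (v x) with hx | hx
  · have hsub {e : L} (he : v e ≤ 1) : v (x - e) = v x :=
      Valuation.map_sub_eq_of_lt_left v (he.trans_lt hx)
    rw [hsub h₁, hsub h₂, hsub h₃] at hv
    rw [hsub h₁]
    have hx0 : v x ≠ 0 := (zero_lt_one.trans hx).ne'
    refine ⟨v y / v x, ?_⟩
    rw [div_mul_div_comm, eq_div_iff (mul_ne_zero hx0 hx0), ← sq (v y), hv, mul_assoc]
  · have hle : v (x - e₁) ≤ 1 := (Valuation.map_sub v x e₁).trans (max_le hx h₁)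
    rcases hle.lt_or_eq with hlt | heq
    · have hone {e : L} (he : v (e₁ - e) = 1) : v (x - e) = 1 := by
        rw [show x - e = (x - e₁) + (e₁ - e) by ring,
          Valuation.map_add_eq_of_lt_right v (by rwa [he]), he]
      rw [hone h₁₂, hone h₁₃, mul_one, mul_one] at hv
      exact ⟨v y, by rw [← hv, sq]⟩
    · rw [heq]
      exact IsSquare.one

end Valuation

namespace WeierstrassCurve.Affine.Point

variable {L : Type*} [Field L] {W : Affine L} [W.IsShortNF]

lemma sq_eq_prod_of_equation {e₁ e₂ e₃ x y : L} (h₀ : e₁ + e₂ + e₃ = 0)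
    (h₄ : W.a₄ = e₁ * e₂ + e₁ * e₃ + e₂ * e₃) (h₆ : W.a₆ = -(e₁ * e₂ * e₃))
    (h : W.Equation x y) : y ^ 2 = (x - e₁) * (x - e₂) * (x - e₃) := by
  have e := (equation_iff ..).1 h
  simp only [a₁_of_isShortNF, a₂_of_isShortNF, a₃_of_isShortNF, zero_mul, add_zero] at e
  rw [e, h₄, h₆]
  linear_combination x ^ 2 * h₀

variable [DecidableEq L]

lemma isSquare_prod_sub_root {e x₁ y₁ x₂ y₂ : L} (he : e ^ 3 + W.a₄ * e + W.a₆ = 0)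
    (h₁ : W.Equation x₁ y₁) (h₂ : W.Equation x₂ y₂) (hx : x₁ ≠ x₂) :
    IsSquare ((x₁ - e) * (x₂ - e) * (W.addX x₁ x₂ (W.slope x₁ x₂ y₁ y₂) - e)) := by
  have i₁ := (equation_iff ..).1 h₁
  have i₂ := (equation_iff ..).1 h₂
  simp only [a₁_of_isShortNF, a₂_of_isShortNF, a₃_of_isShortNF, zero_mul, add_zero] at i₁ i₂
  have hx' : x₁ - x₂ ≠ 0 := sub_ne_zero.2 hx
  refine ⟨(y₁ - y₂) / (x₁ - x₂) * (e - x₁) + y₁, ?_⟩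
  have h4 : W.a₄ = (y₁ ^ 2 - y₂ ^ 2 - (x₁ ^ 3 - x₂ ^ 3)) / (x₁ - x₂) := by
    rw [eq_div_iff hx']
    linear_combination i₂ - i₁
  have h6 : W.a₆ = y₁ ^ 2 - x₁ ^ 3 - W.a₄ * x₁ := by linear_combination -i₁
  rw [h6, h4] at he
  simp only [slope_of_X_ne hx, addX, a₁_of_isShortNF, a₂_of_isShortNF, zero_mul, add_zero,
    sub_zero]
  field_simp at he ⊢
  linear_combination -(x₁ - x₂) * he

/-- A point whose `x`-coordinate differs from each root of the cubic by a square is divisible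
by `2`. -/
lemma exists_add_self_eq_of_sq {e₁ e₂ e₃ x y s₁ s₂ s₃ : L} (h2 : (2 : L) ≠ 0)
    (h₀ : e₁ + e₂ + e₃ = 0) (h₄ : W.a₄ = e₁ * e₂ + e₁ * e₃ + e₂ * e₃)
    (h₆ : W.a₆ = -(e₁ * e₂ * e₃)) (h₁₂ : e₁ ≠ e₂) (h₁₃ : e₁ ≠ e₃) (h₂₃ : e₂ ≠ e₃)
    (h : W.Nonsingular x y) (hs₁ : x - e₁ = s₁ ^ 2) (hs₂ : x - e₂ = s₂ ^ 2)
    (hs₃ : x - e₃ = s₃ ^ 2) (hy : y = s₁ * s₂ * s₃) : ∃ Q : W.Point, Q + Q = some x y h := by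
  obtain rfl : e₁ = x - s₁ ^ 2 := by linear_combination -hs₁
  obtain rfl : e₂ = x - s₂ ^ 2 := by linear_combination -hs₂
  obtain rfl : e₃ = x - s₃ ^ 2 := by linear_combination -hs₃
  have n₁₂ : s₁ + s₂ ≠ 0 := fun h0 ↦ h₁₂ (by linear_combination (s₂ - s₁) * h0)
  have n₁₃ : s₁ + s₃ ≠ 0 := fun h0 ↦ h₁₃ (by linear_combination (s₃ - s₁) * h0)
  have n₂₃ : s₂ + s₃ ≠ 0 := fun h0 ↦ h₂₃ (by linear_combination (s₃ - s₂) * h0)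
  set x₀ := x + s₁ * s₂ + s₁ * s₃ + s₂ * s₃ with hx₀
  set y₀ := (s₁ + s₂) * (s₁ + s₃) * (s₂ + s₃) with hy₀
  have hy₀' : y₀ ≠ 0 := mul_ne_zero (mul_ne_zero n₁₂ n₁₃) n₂₃
  have h2y : 2 * y₀ ≠ 0 := mul_ne_zero h2 hy₀'
  have hn : W.Nonsingular x₀ y₀ := by
    rw [nonsingular_iff', equation_iff]
    simp only [a₁_of_isShortNF, a₂_of_isShortNF, a₃_of_isShortNF, zero_mul, mul_zero, add_zero]
    refine ⟨?_, Or.inr h2y⟩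
    rw [h₄, h₆]
    rw [hx₀, hy₀]
    linear_combination -(x + s₁ * s₂ + s₁ * s₃ + s₂ * s₃) ^ 2 * h₀
  have hneg : W.negY x₀ y₀ = -y₀ := by simp [negY]
  have hY : y₀ ≠ W.negY x₀ y₀ := by
    rw [hneg]
    exact fun h ↦ h2y (by linear_combination h)
  have hslope : W.slope x₀ x₀ y₀ y₀ = s₁ + s₂ + s₃ := by
    rw [slope_of_Y_ne rfl hY, hneg]
    simp only [a₁_of_isShortNF, a₂_of_isShortNF, zero_mul, mul_zero, add_zero, sub_zero,
      sub_neg_eq_add, ← two_mul]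
    rw [div_eq_iff h2y, h₄]
    rw [hx₀, hy₀]
    linear_combination 2 * (x + s₁ * s₂ + s₁ * s₃ + s₂ * s₃) * h₀
  refine ⟨some x₀ y₀ hn, ?_⟩
  rw [add_self_of_Y_ne hY, some.injEq]
  simp only [hslope, addY, negAddY, negY, addX, a₁_of_isShortNF, a₂_of_isShortNF,
    a₃_of_isShortNF, zero_mul, add_zero, sub_zero]
  constructor
  · rw [hx₀]
    linear_combination -h₀
  · rw [hx₀, hy₀, hy]
    linear_combination (s₁ + s₂ + s₃) * h₀

lemma exists_add_self_eq_of_isSquare {e₁ e₂ e₃ x y : L} (h2 : (2 : L) ≠ 0)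
    (h₀ : e₁ + e₂ + e₃ = 0) (h₄ : W.a₄ = e₁ * e₂ + e₁ * e₃ + e₂ * e₃)
    (h₆ : W.a₆ = -(e₁ * e₂ * e₃)) (h₁₂ : e₁ ≠ e₂) (h₁₃ : e₁ ≠ e₃) (h₂₃ : e₂ ≠ e₃)
    (h : W.Nonsingular x y) (hs₁ : IsSquare (x - e₁)) (hs₂ : IsSquare (x - e₂))
    (hs₃ : IsSquare (x - e₃)) : ∃ Q : W.Point, Q + Q = some x y h := by
  obtain ⟨s₁, hs₁⟩ := hs₁
  obtain ⟨s₂, hs₂⟩ := hs₂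
  obtain ⟨s₃, hs₃⟩ := hs₃
  rw [← sq] at hs₁ hs₂ hs₃
  have hy := sq_eq_prod_of_equation h₀ h₄ h₆ h.1
  rw [hs₁, hs₂, hs₃, ← mul_pow, ← mul_pow, sq_eq_sq_iff_eq_or_eq_neg] at hy
  rcases hy with hy | hy
  · exact exists_add_self_eq_of_sq h2 h₀ h₄ h₆ h₁₂ h₁₃ h₂₃ h hs₁ hs₂ hs₃ hy
  · exact exists_add_self_eq_of_sq h2 h₀ h₄ h₆ h₁₂ h₁₃ h₂₃ h (s₁ := -s₁) (by rw [hs₁, neg_sq])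
      hs₂ hs₃ (by rw [hy]; ring)

open IsDedekindDomain NumberField in
/-- The weak Mordell-Weil theorem for elliptic curves with full rational 2-torsion. -/
theorem index_range_two_nsmul_ne_zero_of_roots [NumberField L] {e₁ e₂ e₃ : L}
    (h₀ : e₁ + e₂ + e₃ = 0) (h₄ : W.a₄ = e₁ * e₂ + e₁ * e₃ + e₂ * e₃)
    (h₆ : W.a₆ = -(e₁ * e₂ * e₃)) (h₁₂ : e₁ ≠ e₂) (h₁₃ : e₁ ≠ e₃) (h₂₃ : e₂ ≠ e₃) :
    (nsmulAddMonoidHom (α := W.Point) 2).range.index ≠ 0 := by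
  let O := 𝓞 L
  let Z : Finset L := {e₁, e₂, e₃, (e₁ - e₂)⁻¹, (e₁ - e₃)⁻¹, (e₂ - e₃)⁻¹}
  let S : Set (HeightOneSpectrum O) := ⋃ z ∈ Z, HeightOneSpectrum.Support O z
  have hS : S.Finite := Z.finite_toSet.biUnion fun z _ ↦ HeightOneSpectrum.Support.finite O z
  have hZ {v : HeightOneSpectrum O} (hv : v ∉ S) {z : L} (hz : z ∈ Z) : v.valuation L z ≤ 1 := by
    by_contra! hlt
    exact hv (Set.mem_biUnion hz hlt)
  have hle {v : HeightOneSpectrum O} (hv : v ∉ S) : v.valuation L e₁ ≤ 1 ∧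
      v.valuation L e₂ ≤ 1 ∧ v.valuation L e₃ ≤ 1 :=
    ⟨hZ hv (by simp [Z]), hZ hv (by simp [Z]), hZ hv (by simp [Z])⟩
  have hone {v : HeightOneSpectrum O} {a b : L} (hab : a ≠ b) (ha : v.valuation L a ≤ 1)
      (hb : v.valuation L b ≤ 1) (h : v.valuation L (a - b)⁻¹ ≤ 1) :
      v.valuation L (a - b) = 1 := by
    refine le_antisymm ((Valuation.map_sub _ a b).trans (max_le ha hb)) ?_
    rw [map_inv₀] at h
    exact (inv_le_one₀ (by simpa [zero_lt_iff, sub_eq_zero] using hab)).1 h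
  have hsq {x y : L} (h : W.Equation x y) {v : HeightOneSpectrum O} (hv : v ∉ S) :
      IsSquare (v.valuation L (x - e₁)) ∧ IsSquare (v.valuation L (x - e₂)) ∧
        IsSquare (v.valuation L (x - e₃)) := by
    obtain ⟨l₁, l₂, l₃⟩ := hle hv
    have o₁₂ := hone h₁₂ l₁ l₂ (hZ hv (by simp [Z]))
    have o₁₃ := hone h₁₃ l₁ l₃ (hZ hv (by simp [Z]))
    have o₂₃ := hone h₂₃ l₂ l₃ (hZ hv (by simp [Z]))
    have hy := sq_eq_prod_of_equation h₀ h₄ h₆ h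
    refine ⟨Valuation.isSquare_sub_root _ hy l₁ l₂ l₃ o₁₂ o₁₃,
      Valuation.isSquare_sub_root (e₁ := e₂) (e₂ := e₁) (e₃ := e₃) _ (by rw [hy]; ring)
        l₂ l₁ l₃ (by rwa [Valuation.map_sub_swap]) o₂₃,
      Valuation.isSquare_sub_root (e₁ := e₃) (e₂ := e₁) (e₃ := e₂) _ (by rw [hy]; ring)
        l₃ l₁ l₂ (by rwa [Valuation.map_sub_swap]) (by rwa [Valuation.map_sub_swap])⟩
  have : Group.FG Oˣ := Group.fg_iff_monoid_fg.2 (inferInstanceAs (Monoid.FG (𝓞 L)ˣ))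
  obtain ⟨n, g, hg⟩ := exists_finite_invariant_sq_class L hS
  let T : Set W.Point := {P | P.xRep ∈ ({![1, 0], ![e₁, 1], ![e₂, 1], ![e₃, 1]} : Set (Fin 2 → L))}
  have hT : T.Finite := finite_setOf_xRep_mem (Set.toFinite _)
  let f (P : W.Point) : Fin n × Fin n × Fin n :=
    (g (P.xRep 0 - e₁), g (P.xRep 0 - e₂), g (P.xRep 0 - e₃))
  refine AddSubgroup.index_ne_zero_of_finite_of_notMem hT f fun P hP Q hQ hPQ ↦ ?_
  rcases P with _ | ⟨x₁, y₁, hP'⟩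
  · exact absurd (Or.inl rfl) hP
  rcases Q with _ | ⟨x₂, y₂, hQ'⟩
  · exact absurd (Or.inl rfl) hQ
  have hmem {x y : L} {h : W.Nonsingular x y} (hT : some x y h ∉ T) :
      x - e₁ ≠ 0 ∧ x - e₂ ≠ 0 ∧ x - e₃ ≠ 0 := by
    simpa [T, sub_eq_zero] using hT
  obtain ⟨p₁, p₂, p₃⟩ := hmem hP
  obtain ⟨q₁, q₂, q₃⟩ := hmem hQ
  by_cases hx : x₁ = x₂
  · rcases X_eq_iff (h₁ := hP') (h₂ := hQ') |>.1 hx with h | h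
    · rw [h, neg_add_cancel]
      exact AddSubgroup.zero_mem _
    · rw [h, neg_neg, ← two_nsmul]
      exact ⟨_, rfl⟩
  simp only [f, xRep_some, Matrix.cons_val_zero, Prod.mk.injEq] at hPQ
  have sq₁ := hg _ _ p₁ q₁ (fun v hv ↦ (hsq hP'.1 hv).1) (fun v hv ↦ (hsq hQ'.1 hv).1) hPQ.1
  have sq₂ := hg _ _ p₂ q₂ (fun v hv ↦ (hsq hP'.1 hv).2.1) (fun v hv ↦ (hsq hQ'.1 hv).2.1) hPQ.2.1
  have sq₃ := hg _ _ p₃ q₃ (fun v hv ↦ (hsq hP'.1 hv).2.2) (fun v hv ↦ (hsq hQ'.1 hv).2.2) hPQ.2.2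
  have third {e : L} (he : e ^ 3 + W.a₄ * e + W.a₆ = 0) (p : x₁ - e ≠ 0) (q : x₂ - e ≠ 0)
      (hs : IsSquare ((x₁ - e) * (x₂ - e))) :
      IsSquare (W.addX x₁ x₂ (W.slope x₁ x₂ y₁ y₂) - e) := by
    have := (isSquare_prod_sub_root he hP'.1 hQ'.1 hx).div hs
    rwa [mul_div_cancel_left₀ _ (mul_ne_zero p q)] at this
  obtain ⟨Q, hQ⟩ := exists_add_self_eq_of_isSquare two_ne_zero h₀ h₄ h₆ h₁₂ h₁₃ h₂₃
    (nonsingular_add hP' hQ' fun h ↦ hx h.1)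
    (third (by rw [h₄, h₆]; linear_combination e₁ ^ 2 * h₀) p₁ q₁ sq₁)
    (third (by rw [h₄, h₆]; linear_combination e₂ ^ 2 * h₀) p₂ q₂ sq₂)
    (third (by rw [h₄, h₆]; linear_combination e₃ ^ 2 * h₀) p₃ q₃ sq₃)
  rw [← add_of_X_ne (h₁ := hP') (h₂ := hQ') hx] at hQ
  refine ⟨Q - some x₁ y₁ hP', ?_⟩
  rw [nsmulAddMonoidHom_apply, nsmul_sub, two_nsmul, hQ, two_nsmul]
  abel

end WeierstrassCurve.Affine.Point

/-! ### The Mordell-Weil theorem -/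

namespace WeierstrassCurve

open Polynomial

instance isShortNF_baseChange {F : Type*} [CommRing F] (A : Type*) [CommRing A] [Algebra F A]
    (E : WeierstrassCurve F) [E.IsShortNF] : (E⁄A).IsShortNF where
  a₁ := by simp
  a₂ := by simp [a₂_of_isShortNF]
  a₃ := by simp

open Affine.Point in
lemma fg_point_of_roots {L : Type*} [Field L] [NumberField L] [DecidableEq L]
    (W : WeierstrassCurve L) [W.IsShortNF] [W.IsElliptic] {e₁ e₂ e₃ : L}
    (h₀ : e₁ + e₂ + e₃ = 0) (h₄ : W.a₄ = e₁ * e₂ + e₁ * e₃ + e₂ * e₃)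
    (h₆ : W.a₆ = -(e₁ * e₂ * e₃)) : AddGroup.FG W.toAffine.Point := by
  have hΔ : W.Δ = 16 * ((e₁ - e₂) * (e₁ - e₃) * (e₂ - e₃)) ^ 2 := by
    obtain rfl : e₃ = -e₁ - e₂ := by linear_combination h₀
    rw [Δ_of_isShortNF, h₄, h₆]
    ring
  have hne : (e₁ - e₂) * (e₁ - e₃) * (e₂ - e₃) ≠ 0 := fun h ↦
    W.isUnit_Δ.ne_zero (by rw [hΔ, h]; ring)
  obtain ⟨⟨h₁₂, h₁₃⟩, h₂₃⟩ : (e₁ ≠ e₂ ∧ e₁ ≠ e₃) ∧ e₂ ≠ e₃ := by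
    simpa [mul_ne_zero_iff, sub_ne_zero] using hne
  obtain ⟨C, hC⟩ := exists_abs_logHeight_xRep_add_sub_le (W := W.toAffine)
  have := northcott_logHeight_xRep (W := W.toAffine)
  exact AddCommGroup.fg_of_descent' (h := fun P : W.toAffine.Point ↦ Height.logHeight P.xRep)
    ⟨index_range_two_nsmul_ne_zero_of_roots h₀ h₄ h₆ h₁₂ h₁₃ h₂₃⟩
    (fun P ↦ Height.logHeight_nonneg _) hC

/-- The Mordell-Weil theorem for elliptic curves in short Weierstrass form over a number field. -/
theorem fg_point {F : Type*} [Field F] [NumberField F] [DecidableEq F] (E : WeierstrassCurve F)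
    [E.IsShortNF] [E.IsElliptic] : AddGroup.FG (E⁄F).Point := by
  classical
  let P : Cubic F := ⟨1, 0, E.a₄, E.a₆⟩
  let L := P.toPoly.SplittingField
  have : NumberField L := NumberField.of_module_finite F L
  obtain ⟨e₁, e₂, e₃, h⟩ := (Cubic.splits_iff_roots_eq_three (P := P) (φ := algebraMap F L)
    one_ne_zero).1 (SplittingField.splits _)
  have hb := Cubic.b_eq_three_roots one_ne_zero h
  have hc := Cubic.c_eq_three_roots one_ne_zero h
  have hd := Cubic.d_eq_three_roots one_ne_zero h
  simp only [P, map_one, map_zero, one_mul] at hb hc hd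
  have : (E⁄L).IsElliptic := inferInstanceAs (E.map (algebraMap F L)).IsElliptic
  have hfg : AddGroup.FG (E⁄L).Point :=
    fg_point_of_roots (E⁄L) (e₁ := e₁) (e₂ := e₂) (e₃ := e₃)
      (by linear_combination hb) (by simpa using hc) (by simpa using hd)
  have : Module.Finite ℤ (E⁄L).Point := Module.Finite.iff_addGroup_fg.2 hfg
  exact Module.Finite.iff_addGroup_fg.1 (Module.Finite.of_injective
    (Affine.Point.baseChange (W' := E) F L).toIntLinearMap (Affine.Point.map_injective _))

end WeierstrassCurve

/-! ### Quadratic extensions -/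

namespace QuadTwist

open WeierstrassCurve WeierstrassCurve.Affine

section Quadratic

variable {F K : Type*} [Field F] [Field K] [Algebra F K] {D : F} {δ : K}

lemma finrank_eq_two_of_adjoin_sqrt (hDsq : ¬ IsSquare D) (hδ : δ ^ 2 = algebraMap F K D)
    (hK : IntermediateField.adjoin F {δ} = ⊤) : Module.finrank F K = 2 := by
  open Polynomial in
  have hdeg : (X ^ 2 - C D : F[X]).natDegree = 2 := natDegree_X_pow_sub_C
  have hmonic : (X ^ 2 - C D : F[X]).Monic := monic_X_pow_sub_C D two_ne_zero
  have hroot : aeval δ (X ^ 2 - C D : F[X]) = 0 := by simp [hδ]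
  have hirr : Irreducible (X ^ 2 - C D : F[X]) := by
    refine (irreducible_iff_roots_eq_zero_of_degree_le_three (by rw [hdeg])
      (by rw [hdeg]; norm_num)).2 (Multiset.eq_zero_of_forall_notMem fun x hx ↦ hDsq ⟨x, ?_⟩)
    have := (mem_roots'.1 hx).2
    simp only [IsRoot, eval_sub, eval_pow, eval_X, eval_C] at this
    linear_combination -this
  rw [← IntermediateField.finrank_top', ← hK,
    IntermediateField.adjoin.finrank ⟨_, hmonic, by rwa [← aeval_def]⟩,
    ← minpoly.eq_of_irreducible_of_monic hirr hroot hmonic, hdeg]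

variable {σ : Gal(K/F)}

lemma mem_range_algebraMap_iff_of_zpowers_eq_top [FiniteDimensional F K] [IsGalois F K]
    (hσ : Subgroup.zpowers σ = ⊤) (x : K) : x ∈ Set.range (algebraMap F K) ↔ σ x = x := by
  rw [IsGalois.mem_range_algebraMap_iff_fixed]
  refine ⟨fun h ↦ h σ, fun h τ ↦ ?_⟩
  have hle : Subgroup.zpowers σ ≤ MulAction.stabilizer Gal(K/F) x := by
    rw [Subgroup.zpowers_le]
    exact h
  exact hle (hσ ▸ Subgroup.mem_top τ)

lemma map_sqrt_eq_neg (hDsq : ¬ IsSquare D) (hδ : δ ^ 2 = algebraMap F K D)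
    (hfix : ∀ x : K, x ∈ Set.range (algebraMap F K) ↔ σ x = x) : σ δ = -δ := by
  have h : (σ δ) ^ 2 = δ ^ 2 := by rw [← map_pow, hδ, AlgEquiv.commutes]
  refine (sq_eq_sq_iff_eq_or_eq_neg.1 h).resolve_left fun h' ↦ hDsq ?_
  obtain ⟨d, rfl⟩ := (hfix δ).2 h'
  refine ⟨d, (algebraMap F K).injective ?_⟩
  rw [← hδ, map_mul, sq]

end Quadratic

/-! ### The fixed and anti-fixed points of the Galois action -/

section Points

instance isShortNF_curve {F : Type*} [Field F] (a b : F) : (curve a b).IsShortNF :=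
  ⟨rfl, rfl, rfl⟩

instance isShortNF_twist {F : Type*} [Field F] (a b D : F) : (twist a b D).IsShortNF :=
  isShortNF_curve _ _

lemma isElliptic_twist {F : Type*} [Field F] (a b : F) {D : F} (hD : D ≠ 0)
    [h : (curve a b).IsElliptic] : (twist a b D).IsElliptic := by
  refine ⟨?_⟩
  have h1 : (twist a b D).Δ = D ^ 6 * (curve a b).Δ := by
    rw [Δ_of_isShortNF, Δ_of_isShortNF]
    simp only [twist, curve]
    ring
  rw [h1]
  exact (hD.isUnit.pow 6).mul h.isUnit

variable {F K : Type*} [Field F] [Field K] [Algebra F K] [DecidableEq K]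
  {a b D : F} {δ : K} {σ : Gal(K/F)}

lemma phi_injective (hδ : δ ^ 2 = algebraMap F K D) (hD : D ≠ 0) :
    Function.Injective (phi a b hδ hD) := by
  rw [injective_iff_map_eq_zero]
  rintro (_ | ⟨x, y, h⟩) hP
  · rfl
  · exact absurd hP (Point.some_ne_zero _)

lemma map_map_self_of_sq_eq_one (hσ : σ * σ = 1) (P : ((curve a b)⁄K).Point) :
    Point.map (W' := curve a b) (σ : K →ₐ[F] K)
      (Point.map (W' := curve a b) (σ : K →ₐ[F] K) P) = P := by
  have h (x : K) : σ (σ x) = x := by rw [← AlgEquiv.mul_apply, hσ, AlgEquiv.one_apply]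
  rcases P with _ | ⟨x, y, _⟩
  · rfl
  · exact (Point.some.injEq ..).mpr ⟨h x, h y⟩

variable [DecidableEq F]

lemma mem_EF_iff (hfix : ∀ x : K, x ∈ Set.range (algebraMap F K) ↔ σ x = x)
    (P : ((curve a b)⁄K).Point) :
    P ∈ EF K a b ↔ Point.map (W' := curve a b) (σ : K →ₐ[F] K) P = P := by
  constructor
  · rintro ⟨Q, rfl⟩
    exact Point.map_baseChange _ Q
  · rcases P with _ | ⟨x, y, h⟩
    · exact fun _ ↦ zero_mem _
    · intro hP
      rw [Point.map_some, Point.some.injEq] at hP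
      obtain ⟨x, rfl⟩ := (hfix x).2 hP.1
      obtain ⟨y, rfl⟩ := (hfix y).2 hP.2
      exact ⟨.some x y (((curve a b).toAffine.baseChange_nonsingular
        (Algebra.ofId F K).injective x y).1 h), rfl⟩

lemma map_phi_baseChange (hδ : δ ^ 2 = algebraMap F K D) (hD : D ≠ 0) (hσδ : σ δ = -δ)
    (Q : ((twist a b D)⁄F).Point) :
    Point.map (W' := curve a b) (σ : K →ₐ[F] K) (phi a b hδ hD (Point.baseChange F K Q)) =
      -phi a b hδ hD (Point.baseChange F K Q) := by
  rcases Q with _ | ⟨x, y, h⟩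
  · rfl
  · refine (Point.some.injEq ..).mpr ⟨?_, ?_⟩
    · change σ (algebraMap F K x / δ ^ 2) = algebraMap F K x / δ ^ 2
      rw [map_div₀, map_pow, hσδ, AlgEquiv.commutes, neg_sq]
    · rw [negY_curve]
      change σ (algebraMap F K y / δ ^ 3) = -(algebraMap F K y / δ ^ 3)
      rw [map_div₀, map_pow, hσδ, AlgEquiv.commutes, Odd.neg_pow (by decide), div_neg]

lemma mem_R_iff (hfix : ∀ x : K, x ∈ Set.range (algebraMap F K) ↔ σ x = x)
    (hδ : δ ^ 2 = algebraMap F K D) (hD : D ≠ 0) (hσδ : σ δ = -δ)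
    (P : ((curve a b)⁄K).Point) :
    P ∈ R a b hδ hD ↔ Point.map (W' := curve a b) (σ : K →ₐ[F] K) P = -P := by
  constructor
  · rintro ⟨Q, rfl⟩
    exact map_phi_baseChange hδ hD hσδ Q
  have h0 := sqrt_ne_zero hδ hD
  rcases P with _ | ⟨x, y, h⟩
  · exact fun _ ↦ zero_mem _
  intro hP
  rw [Point.map_some, Point.neg_some, Point.some.injEq, negY_curve] at hP
  obtain ⟨hx, hy⟩ : σ x = x ∧ σ y = -y := hP
  obtain ⟨x, rfl⟩ := (hfix x).2 hx
  obtain ⟨z, hz⟩ := (hfix (y * δ ^ 3)).2 (by rw [map_mul, map_pow, hy, hσδ]; ring)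
  obtain rfl : y = algebraMap F K z / δ ^ 3 := by rw [hz]; field_simp
  rw [nonsingular_curve] at h
  have hns : ((twist a b D)⁄K).Nonsingular (algebraMap F K (x * D)) (algebraMap F K z) := by
    rw [twist, nonsingular_curve]
    simp only [map_mul, map_pow, ← hδ]
    refine ⟨?_, h.2.imp (fun h1 h2 ↦ h1 ?_) (fun h1 h2 ↦ h1 ?_)⟩
    · have := h.1
      field_simp at this
      linear_combination this
    · refine (mul_eq_zero.1 ?_).resolve_left (pow_ne_zero 4 h0)
      linear_combination h2
    · rw [← mul_div_assoc, h2, zero_div]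
  refine ⟨.some (x * D) z (((twist a b D).toAffine.baseChange_nonsingular
    (Algebra.ofId F K).injective (x * D) z).1 hns), ?_⟩
  refine (Point.some.injEq ..).mpr ⟨?_, rfl⟩
  change algebraMap F K (x * D) / δ ^ 2 = algebraMap F K x
  rw [map_mul, ← hδ]
  field_simp

end Points

end QuadTwist

/-! ### The first cohomology group of a group of order two -/

namespace groupCohomology

universe u

/-- For a group `{1, σ}` of order two, `H¹(G, A) = ker (1 + σ) / im (1 - σ)`. -/
theorem card_H1_of_order_two {k G : Type u} [CommRing k] [Group G] (A : Rep.{u} k G) {σ : G}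
    (hσ1 : σ ≠ 1) (hσ2 : σ * σ = 1) (hG : ∀ τ : G, τ = 1 ∨ τ = σ) {R : AddSubgroup A}
    (hR : ∀ x, x ∈ R ↔ A.ρ σ x = -x) :
    Nat.card (H1 A) =
      (AddMonoidHom.id A - (A.ρ σ).toAddMonoidHom).range.relIndex R := by
  classical
  let π : cocycles₁ A →+ H1 A := (H1π A).hom.toAddMonoidHom
  let ψ : cocycles₁ A →+ A := (Pi.evalAddMonoidHom (fun _ ↦ A) σ).comp
    (cocycles₁ A).subtype.toAddMonoidHom
  have hπ : Function.Surjective π := (ModuleCat.epi_iff_surjective (H1π A)).1 inferInstance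
  have hψ : ψ.range = R := by
    ext x
    rw [hR]
    constructor
    · rintro ⟨f, rfl⟩
      have := (mem_cocycles₁_iff f).1 f.2 σ σ
      rw [hσ2, cocycles₁_map_one] at this
      exact eq_neg_of_add_eq_zero_left this.symm
    · intro hx
      refine ⟨⟨fun τ ↦ if τ = 1 then 0 else x, (mem_cocycles₁_iff _).2 fun g h ↦ ?_⟩, if_neg hσ1⟩
      rcases hG g with rfl | rfl <;> rcases hG h with rfl | rfl <;> simp [hσ1, hσ2, hx]
  have hker : π.ker = (AddMonoidHom.id A - (A.ρ σ).toAddMonoidHom).range.comap ψ := by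
    ext f
    rw [AddMonoidHom.mem_ker]
    refine (H1π_eq_zero_iff f).trans ?_
    constructor
    · rintro ⟨x, hx⟩
      refine ⟨-x, ?_⟩
      have := congrFun hx σ
      rw [d₀₁_hom_apply] at this
      change -x - A.ρ σ (-x) = f σ
      rw [← this, map_neg]
      abel
    · rintro ⟨x, hx⟩
      refine ⟨-x, funext fun τ ↦ ?_⟩
      rw [d₀₁_hom_apply]
      rcases hG τ with rfl | rfl
      · simp
      · change x - A.ρ τ x = f τ at hx
        rw [← hx, map_neg]
        abel
  rw [← hψ, ← AddSubgroup.index_comap, ← hker, AddSubgroup.index_ker,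
    AddMonoidHom.range_eq_top.2 hπ]
  exact (Nat.card_congr AddSubgroup.topEquiv.toEquiv).symm

end groupCohomology

theorem theorem2p5 {F : Type*} {K : Type} [Field F] [NumberField F] [Field K] [NumberField K]
    [Algebra F K] [DecidableEq F] [DecidableEq K]
    (D : F) (hD : D ≠ 0) (hDsq : ¬ IsSquare D)
    (δ : K) (hδ : δ ^ 2 = algebraMap F K D) (hK : IntermediateField.adjoin F {δ} = ⊤)
    (σ : Gal(K/F)) (hσ : Subgroup.zpowers σ = ⊤)
    (a b : F) [(QuadTwist.curve a b).IsElliptic] :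
    Finite (QuadTwist.H1 K a b) ∧
    (Nat.card (QuadTwist.H1 K a b) : ℚ) =
      2 ^ Module.finrank ℤ ((QuadTwist.twist a b D)⁄F).Point *
          Nat.card (AddSubgroup.torsionBy ((QuadTwist.curve a b)⁄F).Point 2) /
        (QuadTwist.EF K a b ⊔ QuadTwist.R a b hδ hD).index ∧
    (Nat.card (QuadTwist.H1 K a b) : ℚ) =
      2 ^ Module.finrank ℤ ((QuadTwist.twist a b D)⁄F).Point *
          Nat.card (AddSubgroup.torsionBy ((QuadTwist.curve a b)⁄F).Point 2) /
        ((QuadTwist.EF K a b).map (nsmulAddMonoidHom 2)).relIndex (QuadTwist.N a b σ) ∧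
    (Nat.card (QuadTwist.H1 K a b) : ℚ) =
      2 ^ ((Module.finrank ℤ ((QuadTwist.twist a b D)⁄F).Point : ℤ) -
          Module.finrank ℤ ((QuadTwist.curve a b)⁄F).Point) *
        (QuadTwist.N a b σ).relIndex (QuadTwist.EF K a b) := by
  have hrank := QuadTwist.finrank_eq_two_of_adjoin_sqrt hDsq hδ hK
  have : FiniteDimensional F K := Module.finite_of_finrank_pos (by rw [hrank]; norm_num)
  have : Algebra.IsQuadraticExtension F K := ⟨hrank⟩
  have hfix := QuadTwist.mem_range_algebraMap_iff_of_zpowers_eq_top hσ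
  have hσδ := QuadTwist.map_sqrt_eq_neg hDsq hδ hfix
  have hord : orderOf σ = 2 := by
    rw [← hrank, ← IsGalois.card_aut_eq_finrank]
    exact orderOf_eq_card_of_zpowers_eq_top hσ
  have hσ2 : σ * σ = 1 := by rw [← sq, ← hord, pow_orderOf_eq_one]
  have hσ1 : σ ≠ 1 := by
    rintro rfl
    simp at hord
  have hG (τ : Gal(K/F)) : τ = 1 ∨ τ = σ := by
    have hτ : τ ∈ Subgroup.zpowers σ := hσ ▸ Subgroup.mem_top τ
    obtain ⟨n, rfl⟩ := hτ
    have hσ2' : σ ^ (2 : ℤ) = 1 := by rw [zpow_two, hσ2]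
    rcases Int.even_or_odd' n with ⟨m, rfl | rfl⟩
    · exact Or.inl (by simp only [zpow_mul, hσ2', one_zpow])
    · exact Or.inr (by simp only [zpow_add, zpow_mul, hσ2', one_zpow, one_mul, zpow_one])
  have := QuadTwist.isElliptic_twist a b hD
  have := WeierstrassCurve.fg_point (QuadTwist.curve a b)
  have := WeierstrassCurve.fg_point (QuadTwist.twist a b D)
  have hB := QuadTwist.mem_EF_iff (a := a) (b := b) hfix
  have hR := QuadTwist.mem_R_iff (a := a) (b := b) hfix hδ hD hσδ
  have hcard : Nat.card (QuadTwist.H1 K a b) = (AddMonoidHom.id _ -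
      WeierstrassCurve.Affine.Point.map (W' := QuadTwist.curve a b) (σ : K →ₐ[F] K)).range.relIndex
        (QuadTwist.R a b hδ hD) :=
    groupCohomology.card_H1_of_order_two (Rep.of (QuadTwist.galoisRep K a b)) hσ1 hσ2 hG hR
  obtain ⟨hi, h1, h2, ht⟩ := AddMonoidHom.indices_of_involution
    (g := (QuadTwist.phi a b hδ hD).comp
      (WeierstrassCurve.Affine.Point.baseChange (W' := QuadTwist.twist a b D) F K))
    (WeierstrassCurve.Affine.Point.map_injective (Algebra.ofId F K))
    ((QuadTwist.phi_injective hδ hD).comp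
      (WeierstrassCurve.Affine.Point.map_injective (Algebra.ofId F K)))
    (QuadTwist.map_map_self_of_sq_eq_one hσ2) hB hR
  have hN : ((QuadTwist.EF K a b).map (nsmulAddMonoidHom 2)).relIndex (QuadTwist.N a b σ) =
      (QuadTwist.EF K a b ⊔ QuadTwist.R a b hδ hD).index :=
    AddMonoidHom.relIndex_range_id_add hB hR
  change (QuadTwist.EF K a b ⊔ QuadTwist.R a b hδ hD).index ≠ 0 at hi
  change (QuadTwist.EF K a b ⊔ QuadTwist.R a b hδ hD).index *
    AddSubgroup.relIndex _ (QuadTwist.R a b hδ hD) = _ at h1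
  change (QuadTwist.EF K a b ⊔ QuadTwist.R a b hδ hD).index *
    (QuadTwist.N a b σ).relIndex (QuadTwist.EF K a b) = _ at h2
  rw [← hcard] at h1
  rw [hN]
  have hi' : ((QuadTwist.EF K a b ⊔ QuadTwist.R a b hδ hD).index : ℚ) ≠ 0 := by exact_mod_cast hi
  have h1' := congrArg (Nat.cast : ℕ → ℚ) h1
  have h2' := congrArg (Nat.cast : ℕ → ℚ) h2
  push_cast at h1' h2'
  have hfirst := (eq_div_iff hi').2 ((mul_comm _ _).trans h1')
  refine ⟨Nat.finite_of_card_ne_zero fun h0 ↦ ?_, hfirst, hfirst, ?_⟩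
  · rw [h0, mul_zero, eq_comm, mul_eq_zero] at h1
    exact h1.elim (by simp) ht
  · rw [zpow_sub₀ two_ne_zero, zpow_natCast, zpow_natCast, div_mul_eq_mul_div,
      eq_div_iff (by positivity), ← mul_right_inj' hi', ← mul_assoc, h1']
    linear_combination -2 ^ Module.finrank ℤ ((QuadTwist.twist a b D)⁄F).Point * h2'
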